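/- Let $p,q\ge 3$ be integers, and let $\mathbb X$ be the sphere, the Euclidean plane or the hyperbolic plane according as $\frac1p+\frac1q-\frac12$ is positive, zero or negative. Let $F\subset\mathbb X$ be a triangle with angles $\frac\pi2,\frac\pi p,\frac\pi q$, and let $a,b,c$ be the reflections in the lines spanned by the sides of $F$ opposite to the angles $\frac\pi p,\frac\pi2,\frac\pi q$, respectively. Let $G_{p,q}=\langle a,b,c\rangle$ and let $\bar G_{p,q}=\langle ab,ac\rangle$ be its rotation subgroup. The triangles $fF$ ($f\in G_{p,q}$) tile $\mathbb X$. The regular tilings $(q^p)$ (by $q$-gons, $p$ at each vertex) and $(p^q)$ (by $p$-gons, $q$ at each vertex) and the Laves tiling $[p.q.p.q]$ (by quadrilaterals) consist of the images under $G_{p,q}$ of the tiles $$\bigcup_{w\in\langle a,b\rangle}wF,\qquad \bigcup_{w\in\langle b,c\rangle}wF,\qquad \bigcup_{w\in\langle a,c\rangle}wF,$$ respectively. A $k$-colouring of a tiling is a surjective map from its set of tiles to $\{1,\dots,k\}$; it is perfect with respect to $\bar G_{p,q}$ if for every $h\in\bar G_{p,q}$ there is a permutation $\pi_h$ of $\{1,\dots,k\}$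 such that, for every tile $t$, $ht$ is a tile whose colour is the image under $\pi_h$ of the colour of $t$. Let $S$ be a subgroup of $\bar G_{p,q}$ of finite index $k$, and let $r\in\{a,b,c\}$, so that $F\cup rF$ is a fundamental domain of $\bar G_{p,q}$. The left coset colouring given by $S$ and $r$ numbers the left cosets of $S$ in $\bar G_{p,q}$ as $S=S_1,\dots,S_k$ and gives both triangles $fF$ and $frF$ the colour $i$ whenever $f\in S_i$. We say that $S$ induces (by way of $r$) a perfect $k$-colouring of one of the three tilings if, for some such numbering, all triangles contained in a common tile have the same colour, and giving each tile the colour of its triangles is a $k$-colouring that is perfect with respect to $\bar G_{p,q}$. Then: 1. for $r\in\{a,b\}$, $S$ induces a perfect $k$-colouring of $(q^p)$ if and only if $ab\in S$; 2. for $r\in\{a,c\}$, $S$ induces a perfect $k$-colouring of $[p.q.p.q]$ if and only if $ac\in S$; 3. for $r\in\{b,c\}$, $S$ induces a perfect $k$-colouring of $(p^q)$ if and only if $bc\in S$. -/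

import Mathlib

noncomputable section

namespace RegTiling

/-! ### The sphere, the Euclidean plane and the hyperbolic plane

For `ε = 1, 0, -1` the set `Plane ε ⊆ ℝ³` is, respectively, the unit sphere
`x₀² + x₁² + x₂² = 1`, the affine plane `x₂ = 1`, and the upper sheet `x₂ > 0` of the hyperboloid
`x₀² + x₁² - x₂² = -1`. -/

/-- The model plane of curvature `ε` (used for `ε = 1, 0, -1`). -/
def Plane (ε : ℝ) : Type :=
  {x : Fin 3 → ℝ // ε * (x 0 ^ 2 + x 1 ^ 2) + x 2 ^ 2 = 1 ∧ (ε ≤ 0 → 0 < x 2)}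

/-- Pairing of a covector with a vector. -/
def pair (n x : Fin 3 → ℝ) : ℝ := n 0 * x 0 + n 1 * x 1 + n 2 * x 2

/-- The squared chord length of two points: it determines the distance, being `(2 sin (d/2))²` on
the sphere, `d²` in the Euclidean plane and `(2 sinh (d/2))²` in the hyperbolic plane. -/
def quadrance {ε : ℝ} (x y : Plane ε) : ℝ :=
  (x.1 0 - y.1 0) ^ 2 + (x.1 1 - y.1 1) ^ 2 + ε * (x.1 2 - y.1 2) ^ 2

/-- The symmetric bilinear form on covectors. For unit covectors `m`, `n`, the half planes
`pair m x ≥ 0` and `pair n x ≥ 0` meet in the angle `θ` with `cos θ = - coForm ε m n`. -/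
def coForm (ε : ℝ) (m n : Fin 3 → ℝ) : ℝ := m 0 * n 0 + m 1 * n 1 + ε * (m 2 * n 2)

/-- The map `x ↦ x - 2 ⟨n, x⟩ n♯`, for a unit covector `n` the reflection in the line
`⟨n, x⟩ = 0`. -/
def reflFun (ε : ℝ) (n x : Fin 3 → ℝ) : Fin 3 → ℝ :=
  ![x 0 - 2 * pair n x * n 0, x 1 - 2 * pair n x * n 1, x 2 - 2 * pair n x * (ε * n 2)]

theorem reflFun_mem {ε : ℝ} {n : Fin 3 → ℝ} (hn : coForm ε n n = 1) (x : Plane ε) :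
    ε * (reflFun ε n x.1 0 ^ 2 + reflFun ε n x.1 1 ^ 2) + reflFun ε n x.1 2 ^ 2 = 1 ∧
      (ε ≤ 0 → 0 < reflFun ε n x.1 2) := by
  obtain ⟨x, h1, h2⟩ := x
  simp only [coForm] at hn
  simp only [reflFun, pair, Matrix.cons_val]
  refine ⟨?_, fun hε => ?_⟩
  · linear_combination h1 + 4 * ε * (n 0 * x 0 + n 1 * x 1 + n 2 * x 2) ^ 2 * hn
  · have hx := h2 hε
    set u := n 0 * x 0 + n 1 * x 1 with hu
    set m := -ε * n 2 ^ 2 with hm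
    have hm0 : 0 ≤ m := mul_nonneg (by linarith) (sq_nonneg _)
    have hcs : u ^ 2 ≤ (1 + m) * (x 0 ^ 2 + x 1 ^ 2) := by
      have : (1 + m) = n 0 ^ 2 + n 1 ^ 2 := by rw [hm]; linear_combination -hn
      rw [this, hu]; nlinarith [sq_nonneg (n 0 * x 1 - n 1 * x 0)]
    have hsq : (2 * ε * n 2 * u) ^ 2 < ((1 + 2 * m) * x 2) ^ 2 := by
      have e1 : (2 * ε * n 2 * u) ^ 2 = 4 * m * (-ε) * u ^ 2 := by rw [hm]; ring
      have e2 : 4 * m * (-ε) * u ^ 2 ≤ 4 * m * (-ε) * ((1 + m) * (x 0 ^ 2 + x 1 ^ 2)) :=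
        mul_le_mul_of_nonneg_left hcs (mul_nonneg (by linarith) (by linarith))
      have e3 : 4 * m * (-ε) * ((1 + m) * (x 0 ^ 2 + x 1 ^ 2)) = 4 * m * (1 + m) * (x 2 ^ 2 - 1) := by
        linear_combination (-4 * m * (1 + m)) * h1
      nlinarith [mul_nonneg hm0 hm0, pow_pos hx 2]
    have hlt := abs_lt_of_sq_lt_sq hsq (by positivity)
    have := (abs_lt.1 hlt).2
    have e : x 2 - 2 * (u + n 2 * x 2) * (ε * n 2) = (1 + 2 * m) * x 2 - 2 * ε * n 2 * u := by
      rw [hm]; ring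
    rw [e]; linarith

theorem reflFun_reflFun {ε : ℝ} {n : Fin 3 → ℝ} (hn : coForm ε n n = 1) (x : Fin 3 → ℝ) :
    reflFun ε n (reflFun ε n x) = x := by
  simp only [coForm] at hn
  ext i
  fin_cases i <;> simp only [reflFun, pair, Matrix.cons_val, Fin.zero_eta, Fin.mk_one, Fin.reduceFinMk]
  · linear_combination 4 * n 0 * (n 0 * x 0 + n 1 * x 1 + n 2 * x 2) * hn
  · linear_combination 4 * n 1 * (n 0 * x 0 + n 1 * x 1 + n 2 * x 2) * hn
  · linear_combination 4 * ε * n 2 * (n 0 * x 0 + n 1 * x 1 + n 2 * x 2) * hn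

/-- The reflection of the model plane in the line `⟨n, x⟩ = 0`. -/
def refl {ε : ℝ} (n : Fin 3 → ℝ) (hn : coForm ε n n = 1) : Equiv.Perm (Plane ε) where
  toFun x := ⟨reflFun ε n x.1, reflFun_mem hn x⟩
  invFun x := ⟨reflFun ε n x.1, reflFun_mem hn x⟩
  left_inv x := Subtype.ext (reflFun_reflFun hn x.1)
  right_inv x := Subtype.ext (reflFun_reflFun hn x.1)

/-- Reflections are isometries. -/
theorem quadrance_refl {ε : ℝ} (hε : ε = 1 ∨ ε = 0 ∨ ε = -1) (n : Fin 3 → ℝ)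
    (hn : coForm ε n n = 1) (x y : Plane ε) :
    quadrance (refl n hn x) (refl n hn y) = quadrance x y := by
  have h : ∀ z : Plane ε, (refl n hn z).1 = reflFun ε n z.1 := fun _ => rfl
  simp only [quadrance, h, reflFun, pair, Matrix.cons_val]
  simp only [coForm] at hn
  have hxy : (1 - ε ^ 2) * (x.1 2 - y.1 2) = 0 := by
    rcases hε with rfl | rfl | rfl
    · ring
    · have e : ∀ z : Plane 0, z.1 2 = 1 := fun z => by
        have h1 := z.2.1
        have h2 := z.2.2 le_rfl
        nlinarith
      rw [e x, e y]; ring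
    · ring
  have he : ε ^ 3 = ε := by rcases hε with rfl | rfl | rfl <;> norm_num
  set u := n 0 * (x.1 0 - y.1 0) + n 1 * (x.1 1 - y.1 1) + n 2 * (x.1 2 - y.1 2) with hu
  linear_combination 4 * u ^ 2 * hn + 4 * u ^ 2 * n 2 ^ 2 * he + 4 * u * n 2 * hxy

/-! ### The triangle `F` with angles `π/2`, `π/p`, `π/q` and the reflections in its sides -/

/-- `1 - cos² (π/p) - cos² (π/q)`, the determinant of the Gram matrix of the triangle. -/
def gram (p q : ℕ) : ℝ := 1 - Real.cos (Real.pi / q) ^ 2 - Real.cos (Real.pi / p) ^ 2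

/-- The curvature `1`, `0` or `-1` of the plane that is tiled. -/
def curv (p q : ℕ) : ℝ := Real.sign (gram p q)

/-- The curvature is the sign of `1/p + 1/q - 1/2`. -/
theorem curv_eq {p q : ℕ} (hp : 3 ≤ p) (hq : 3 ≤ q) :
    curv p q = Real.sign (1 / (p : ℝ) + 1 / (q : ℝ) - 1 / 2) := by
  have hp' : (3 : ℝ) ≤ p := by exact_mod_cast hp
  have hq' : (3 : ℝ) ≤ q := by exact_mod_cast hq
  have hπ := Real.pi_pos
  have key : ∀ m : ℝ, 3 ≤ m → 0 < Real.pi / m ∧ Real.pi / m ≤ Real.pi / 3 := fun m hm =>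
    ⟨div_pos hπ (by linarith), div_le_div_of_nonneg_left hπ.le (by norm_num) hm⟩
  obtain ⟨hα0, hα1⟩ := key p hp'
  obtain ⟨hβ0, hβ1⟩ := key q hq'
  have hsum : 1 / (p : ℝ) + 1 / (q : ℝ) - 1 / 2
      = (Real.pi / p + Real.pi / q - Real.pi / 2) / Real.pi := by field_simp
  have hg : gram p q = -(Real.cos (Real.pi / p + Real.pi / q)) *
      Real.cos (Real.pi / p - Real.pi / q) := by
    rw [gram, Real.cos_add, Real.cos_sub]
    linear_combination (-Real.sin (Real.pi / q) ^ 2) * Real.sin_sq_add_cos_sq (Real.pi / p)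
      + (Real.cos (Real.pi / p) ^ 2 - 1) * Real.sin_sq_add_cos_sq (Real.pi / q)
  have hd : 0 < Real.cos (Real.pi / p - Real.pi / q) :=
    Real.cos_pos_of_mem_Ioo ⟨by linarith, by linarith⟩
  rw [curv, hsum, hg]
  rcases lt_trichotomy (Real.pi / p + Real.pi / q) (Real.pi / 2) with h | h | h
  · have hc : 0 < Real.cos (Real.pi / p + Real.pi / q) :=
      Real.cos_pos_of_mem_Ioo ⟨by linarith, h⟩
    rw [Real.sign_of_neg (mul_neg_of_neg_of_pos (by linarith) hd),
      Real.sign_of_neg (div_neg_of_neg_of_pos (by linarith) hπ)]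
  · rw [h]; simp
  · have hc : Real.cos (Real.pi / p + Real.pi / q) < 0 :=
      Real.cos_neg_of_pi_div_two_lt_of_lt h (by linarith)
    rw [Real.sign_of_pos (mul_pos (by linarith) hd),
      Real.sign_of_pos (div_pos (by linarith) hπ)]

/-- The sphere, the Euclidean plane or the hyperbolic plane, according to `p` and `q`. -/
abbrev X (p q : ℕ) : Type := Plane (curv p q)

/-- The third coordinate of the covector of the hypotenuse (in the Euclidean case, where it fixes
the size of the triangle, it is taken to be `1`). -/
def height (p q : ℕ) : ℝ := if gram p q = 0 then 1 else √|gram p q|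

/-- The side opposite to the angle `π/p`. -/
def normA : Fin 3 → ℝ := ![1, 0, 0]

/-- The side opposite to the right angle. -/
def normB (p q : ℕ) : Fin 3 → ℝ :=
  ![-Real.cos (Real.pi / q), -Real.cos (Real.pi / p), height p q]

/-- The side opposite to the angle `π/q`. -/
def normC : Fin 3 → ℝ := ![0, 1, 0]

theorem coForm_normA (ε : ℝ) : coForm ε normA normA = 1 := by simp [coForm, normA]

theorem coForm_normC (ε : ℝ) : coForm ε normC normC = 1 := by simp [coForm, normC]

theorem coForm_normB (p q : ℕ) : coForm (curv p q) (normB p q) (normB p q) = 1 := by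
  have h : curv p q * (height p q * height p q) = gram p q := by
    unfold curv height
    rcases lt_trichotomy (gram p q) 0 with h | h | h
    · rw [if_neg h.ne, Real.mul_self_sqrt (abs_nonneg _), Real.sign_of_neg h, abs_of_neg h]; ring
    · simp [h]
    · rw [if_neg h.ne', Real.mul_self_sqrt (abs_nonneg _), Real.sign_of_pos h, abs_of_pos h]; ring
  simp only [coForm, normB, Matrix.cons_val]
  rw [h, gram]; ring

/-- The triangle has the angles `π/q` (sides `a`, `b`), `π/2` (sides `a`, `c`), `π/p`
(sides `b`, `c`). -/
theorem coForm_angles (p q : ℕ) :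
    coForm (curv p q) normA (normB p q) = -Real.cos (Real.pi / q) ∧
    coForm (curv p q) normA normC = -Real.cos (Real.pi / 2) ∧
    coForm (curv p q) (normB p q) normC = -Real.cos (Real.pi / p) := by
  simp [coForm, normA, normB, normC]

/-- The right-angled triangle `F`. -/
def F (p q : ℕ) : Set (X p q) :=
  {x | 0 ≤ pair normA x.1 ∧ 0 ≤ pair (normB p q) x.1 ∧ 0 ≤ pair normC x.1}

/-- The reflection in the side opposite to the angle `π/p`. -/
def a (p q : ℕ) : Equiv.Perm (X p q) := refl normA (coForm_normA _)

/-- The reflection in the side opposite to the right angle. -/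
def b (p q : ℕ) : Equiv.Perm (X p q) := refl (normB p q) (coForm_normB p q)

/-- The reflection in the side opposite to the angle `π/q`. -/
def c (p q : ℕ) : Equiv.Perm (X p q) := refl normC (coForm_normC _)

/-! ### The groups -/

/-- The group generated by the three reflections. -/
def G (p q : ℕ) : Subgroup (Equiv.Perm (X p q)) := Subgroup.closure {a p q, b p q, c p q}

/-- The rotation group, generated by `ab` and `ac`. -/
def rotG (p q : ℕ) : Subgroup (Equiv.Perm (X p q)) :=
  Subgroup.closure {a p q * b p q, a p q * c p q}

theorem b_mul_b (p q : ℕ) : b p q * b p q = 1 :=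
  Equiv.ext fun x => Subtype.ext (reflFun_reflFun (coForm_normB p q) x.1)

/-- The rotation `ab` about the vertex of `F` with angle `π/q`. -/
def ab (p q : ℕ) : rotG p q := ⟨a p q * b p q, Subgroup.subset_closure (Or.inl rfl)⟩

/-- The rotation `ac` about the vertex of `F` with the right angle. -/
def ac (p q : ℕ) : rotG p q := ⟨a p q * c p q, Subgroup.subset_closure (Or.inr rfl)⟩

/-- The rotation `bc` about the vertex of `F` with angle `π/p`. -/
def bc (p q : ℕ) : rotG p q := ⟨b p q * c p q, by
  have h : b p q * c p q = ((ab p q)⁻¹ * ac p q : rotG p q) := by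
    have hb : (b p q)⁻¹ = b p q := inv_eq_of_mul_eq_one_left (b_mul_b p q)
    simp [ab, ac, mul_assoc, hb]
  rw [h]; exact SetLike.coe_mem _⟩

/-! ### The tilings -/

/-- The tiling `T_{p,q}` by the triangles `f F`, `f ∈ G`. -/
def triangles (p q : ℕ) : Set (Set (X p q)) := {Δ | ∃ f ∈ G p q, Δ = f '' F p q}

/-- The polygon made of the triangles `w F`, where `w` runs through the (dihedral) group generated
by the reflections `r` and `s`. -/
def polygon (p q : ℕ) (r s : Equiv.Perm (X p q)) : Set (X p q) :=
  ⋃ w ∈ Subgroup.closure {r, s}, w '' F p q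

/-- The tiling by the images of this polygon under `G`. -/
def tilingOf (p q : ℕ) (r s : Equiv.Perm (X p q)) : Set (Set (X p q)) :=
  {t | ∃ g ∈ G p q, t = g '' polygon p q r s}

/-- The regular tiling `(q^p)`: each tile is a regular `q`-gon, made of the `2q` triangles around a
vertex with angle `π/q`. -/
def tilingQP (p q : ℕ) : Set (Set (X p q)) := tilingOf p q (a p q) (b p q)

/-- The Laves tiling `[p.q.p.q]`: each tile is a quadrilateral, made of the four triangles around a
vertex with angle `π/2`; its edges join the centres of the `p`-gons of `(p^q)` to their vertices. -/
def tilingLaves (p q : ℕ) : Set (Set (X p q)) := tilingOf p q (a p q) (c p q)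

/-- The regular tiling `(p^q)`: each tile is a regular `p`-gon, made of the `2p` triangles around a
vertex with angle `π/p`. -/
def tilingPQ (p q : ℕ) : Set (Set (X p q)) := tilingOf p q (b p q) (c p q)

/-! ### Colourings -/

variable {p q k : ℕ}

/-- `(h, π)` is a colour symmetry of the coloured tiling `(𝒯, col)`: `h` maps tiles to tiles and
permutes the colours by `π`. -/
def IsColourSymmetry {𝒯 : Set (Set (X p q))} (col : 𝒯 → Fin k) (h : Equiv.Perm (X p q))
    (π : Equiv.Perm (Fin k)) : Prop :=
  ∀ t : 𝒯, ∃ ht : h '' t.1 ∈ 𝒯, col ⟨h '' t.1, ht⟩ = π (col t)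

/-- `col` is a `k`-colouring of `𝒯` that is perfect with respect to the rotation group. -/
def IsPerfectColouring {𝒯 : Set (Set (X p q))} (col : 𝒯 → Fin k) : Prop :=
  Function.Surjective col ∧
    ∀ h ∈ rotG p q, ∃ π : Equiv.Perm (Fin k), IsColourSymmetry col h π

/-- `γ` is a left coset colouring of the triangles by the subgroup `S` of the rotation group, with
respect to the fundamental domain `F ∪ r F` of the rotation group (`r` one of `a`, `b`, `c`): for
some numbering `e` of the left cosets of `S`, starting with `S` itself, both triangles in
`f (F ∪ r F)` get the number of the coset `f S`. -/
def IsLeftCosetColouring (S : Subgroup (rotG p q)) (r : Equiv.Perm (X p q))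
    (γ : triangles p q → Fin k) : Prop :=
  ∃ e : (rotG p q ⧸ S) ≃ Fin k, (e ((1 : rotG p q) : rotG p q ⧸ S) : ℕ) = 0 ∧
    ∀ (f : rotG p q) (Δ : triangles p q),
      Δ.1 = f.1 '' F p q ∨ Δ.1 = f.1 '' (r '' F p q) → γ Δ = e (f : rotG p q ⧸ S)

/-- `S` induces, by way of the fundamental domain `F ∪ r F`, a `k`-colouring of `𝒯` that is perfect
with respect to the rotation group: in the left coset colouring, all the triangles that form a tile
have the same colour, and giving the tile this colour is such a colouring. -/
def InducesPerfect (S : Subgroup (rotG p q)) (r : Equiv.Perm (X p q)) (k : ℕ)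
    (𝒯 : Set (Set (X p q))) : Prop :=
  ∃ (γ : triangles p q → Fin k) (col : 𝒯 → Fin k),
    IsLeftCosetColouring S r γ ∧
    (∀ (t : 𝒯) (Δ : triangles p q), Δ.1 ⊆ t.1 → col t = γ Δ) ∧
    IsPerfectColouring col

end RegTiling

end

/-!
Let `W` be the Coxeter group of the triangle. By Tits' theorem on the fundamental chamber, `W` acts
simply transitively on the triangles `g F`; in particular `G` is `W`, and no reflection is a
rotation, because the two differ in the parity of their length.

Let `r`, `s` be two of the reflections and `P` the union of the triangles `w F`, `w ∈ ⟨r, s⟩`. Every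
tile is `f P` for a rotation `f`, and `⟨r, s⟩` meets the rotation group in `⟨r s⟩`. Hence giving the
tile `f P` the colour of the coset `f S` is unambiguous if and only if `r s ∈ S`, and left
multiplication on the cosets then supplies the permutations of the colours.
-/

namespace RegTiling

open CoxeterSystem (alternatingWord)
open Polynomial.Chebyshev (U)
open Real (cos sin)

section Chebyshev

/-! ### Pairs of reflections and Chebyshev polynomials -/

/-- Two permutations `σ`, `τ` that act on two scalar functions `u`, `v` like the reflections in the
lines `u = 0` and `v = 0`; over `ℝ`, with `c = cos θ`, these lines meet in the angle `θ`. -/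
structure IsReflectionPair {Y R : Type*} [CommRing R] (c : R) (σ τ : Equiv.Perm Y)
    (u v : Y → R) : Prop where
  fst_fst : ∀ y, u (σ y) = -u y
  snd_fst : ∀ y, v (σ y) = v y + 2 * c * u y
  fst_snd : ∀ y, u (τ y) = u y + 2 * c * v y
  snd_snd : ∀ y, v (τ y) = -v y

theorem IsReflectionPair.apply_mul_pow {Y R : Type*} [CommRing R] {c : R} {σ τ : Equiv.Perm Y}
    {u v : Y → R} (h : IsReflectionPair c σ τ u v) (n : ℕ) (y : Y) :
    u (((σ * τ) ^ n) y) =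
        -(U R (2 * n - 2)).eval c * u y - (U R (2 * n - 1)).eval c * v y ∧
      v (((σ * τ) ^ n) y) =
        (U R (2 * n - 1)).eval c * u y + (U R (2 * n)).eval c * v y := by
  have eval_add_two (m : ℤ) :
      (U R (m + 2)).eval c = 2 * c * (U R (m + 1)).eval c - (U R m).eval c := by
    simp [Polynomial.Chebyshev.U_add_two]
  induction n with
  | zero => simp
  | succ n ih =>
    obtain ⟨ihu, ihv⟩ := ih
    have h₀ := eval_add_two (2 * n - 2)
    have h₁ := eval_add_two (2 * n - 1)
    have h₂ := eval_add_two (2 * n)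
    rw [show (2 * n - 2 + 2 : ℤ) = 2 * n by ring,
      show (2 * n - 2 + 1 : ℤ) = 2 * n - 1 by ring] at h₀
    rw [show (2 * n - 1 + 2 : ℤ) = 2 * n + 1 by ring,
      show (2 * n - 1 + 1 : ℤ) = 2 * n by ring] at h₁
    rw [pow_succ', Equiv.Perm.mul_apply, Equiv.Perm.mul_apply, h.fst_fst, h.snd_fst, h.fst_snd,
      h.snd_snd, ihu, ihv]
    push_cast
    rw [show (2 * (n + 1) - 2 : ℤ) = 2 * n by ring, show (2 * (n + 1) - 1 : ℤ) = 2 * n + 1 by ring,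
      show (2 * (n + 1) : ℤ) = 2 * n + 2 by ring, h₂, h₁, h₀]
    constructor <;> ring

theorem sin_pi_div_pos {m : ℕ} (hm : 2 ≤ m) : 0 < sin (Real.pi / m) := by
  have hm' : (1 : ℝ) < m := by exact_mod_cast hm
  exact Real.sin_pos_of_pos_of_lt_pi (by positivity) (div_lt_self Real.pi_pos hm')

/-- Here and below, `m = 0` encodes `m = ∞`, in keeping with the convention for Coxeter matrices
and with `π / 0 = 0`. -/
theorem U_eval_cos_pi_div_pos {m n : ℕ} (h : m = 0 ∨ n + 1 < m) :
    0 < (U ℝ n).eval (cos (Real.pi / m)) := by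
  rcases h with rfl | hnm
  · simp only [Nat.cast_zero, div_zero, Real.cos_zero, Polynomial.Chebyshev.U_eval_one]
    positivity
  · have hsin : 0 < sin ((n + 1) * (Real.pi / m)) := by
      have hnm' : (n + 1 : ℝ) < m := by exact_mod_cast hnm
      have hm : (0 : ℝ) < m := by linarith [n.cast_nonneg (α := ℝ)]
      refine Real.sin_pos_of_pos_of_lt_pi (by positivity) ?_
      rw [mul_div_assoc', div_lt_iff₀ hm, mul_comm]
      gcongr
    refine pos_of_mul_pos_left ?_ (sin_pi_div_pos (m := m) (by lia)).le
    rw [Polynomial.Chebyshev.U_real_cos]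
    exact_mod_cast hsin

theorem U_eval_cos_pi_div_nonneg {m n : ℕ} (hm : m ≠ 1) (h : m = 0 ∨ n + 1 ≤ m) :
    0 ≤ (U ℝ n).eval (cos (Real.pi / m)) := by
  by_cases hlt : m = 0 ∨ n + 1 < m
  · exact (U_eval_cos_pi_div_pos hlt).le
  · obtain rfl : m = n + 1 := by lia
    have hzero := Polynomial.Chebyshev.U_real_cos (Real.pi / (n + 1 : ℕ)) n
    rw [Int.cast_natCast, Nat.cast_add_one, mul_div_cancel₀ _ (by positivity), Real.sin_pi,
      ← Nat.cast_add_one] at hzero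
    exact ((mul_eq_zero_iff_right (sin_pi_div_pos (by lia)).ne').1 hzero).ge

theorem U_two_mul_add_eval_cos_pi_div {m : ℕ} (hm : 2 ≤ m) (n : ℤ) :
    (U ℝ (2 * m + n)).eval (cos (Real.pi / m)) = (U ℝ n).eval (cos (Real.pi / m)) := by
  have hm₀ : (m : ℝ) ≠ 0 := by positivity
  refine mul_right_cancel₀ (sin_pi_div_pos hm).ne' ?_
  rw [Polynomial.Chebyshev.U_real_cos, Polynomial.Chebyshev.U_real_cos,
    ← Real.sin_add_two_pi ((n + 1) * (Real.pi / m))]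
  congr 1
  push_cast
  field_simp
  ring

end Chebyshev

section Tits

/-! ### Tits' theorem on the fundamental chamber of a Coxeter group -/

variable {B W : Type*} [Group W] {M : CoxeterMatrix B} (cs : CoxeterSystem M W)

theorem lt_of_eq_mul_alternatingWord {v w : W} {i j : B} {n : ℕ}
    (hw : w = v * cs.wordProd (alternatingWord i j n)) (hlen : cs.length v + n = cs.length w)
    (hi : ¬ cs.IsRightDescent w i) : M i j = 0 ∨ n < M i j := by
  by_contra! hM
  have hred : cs.IsReduced (alternatingWord j i (n + 1)) := by
    have hwi : w * cs.simple i = v * cs.wordProd (alternatingWord j i (n + 1)) := by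
      rw [hw, CoxeterSystem.alternatingWord_succ, cs.wordProd_concat, mul_assoc]
    have hle := cs.length_wordProd_le (alternatingWord j i (n + 1))
    have hmul := cs.length_mul_le v (cs.wordProd (alternatingWord j i (n + 1)))
    rw [← hwi, cs.not_isRightDescent_iff.1 hi] at hmul
    rw [CoxeterSystem.IsReduced]
    rw [CoxeterSystem.length_alternatingWord] at hle ⊢
    lia
  rw [M.symmetric] at hM
  exact cs.not_isReduced_alternatingWord j i hM.1 (by lia) hred

theorem exists_eq_mul_alternatingWord {w : W} {i j : B} (hi : ¬ cs.IsRightDescent w i) :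
    ∃ v n, w = v * cs.wordProd (alternatingWord i j n) ∧ cs.length v + n = cs.length w ∧
      ¬ cs.IsRightDescent v i ∧ ¬ cs.IsRightDescent v j := by
  obtain ⟨⟨v, n⟩, ⟨hw, hlen⟩, hmin⟩ := (measure fun d : W × ℕ => cs.length d.1).wf.has_min
    {d | w = d.1 * cs.wordProd (alternatingWord i j d.2) ∧ cs.length d.1 + d.2 = cs.length w}
    ⟨(w, 0), by simp [alternatingWord]⟩
  -- The next letter of the alternating word is no descent of `v`, as `v` is as short as possible.
  have hnext : ¬ cs.IsRightDescent v (if Even n then j else i) := by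
    intro hdesc
    refine hmin (v * cs.simple (if Even n then j else i), n + 1) ⟨?_, ?_⟩ hdesc
    · rw [CoxeterSystem.alternatingWord_succ', cs.wordProd_cons, mul_assoc,
        cs.simple_mul_simple_cancel_left, hw]
    · have := cs.isRightDescent_iff.1 hdesc
      lia
  -- Nor is the previous one, since it could be cancelled.
  have hprev : ¬ cs.IsRightDescent v (if Even n then i else j) := by
    intro hdesc
    cases n with
    | zero => simp_all [alternatingWord]
    | succ n =>
      have hletter : (if Even (n + 1) then i else j) = if Even n then j else i := by
        simp only [Nat.even_add_one, ite_not]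
      rw [hletter] at hdesc
      rw [CoxeterSystem.alternatingWord_succ', cs.wordProd_cons, ← mul_assoc] at hw
      have hmul := cs.length_mul_le (v * cs.simple (if Even n then j else i))
        (cs.wordProd (alternatingWord i j n))
      have hle := cs.length_wordProd_le (alternatingWord i j n)
      rw [CoxeterSystem.length_alternatingWord] at hle
      rw [← hw] at hmul
      have := cs.isRightDescent_iff.1 hdesc
      lia
  refine ⟨v, n, hw, hlen, ?_⟩
  split_ifs at hnext hprev
  exacts [⟨hprev, hnext⟩, ⟨hnext, hprev⟩]

variable {Y : Type*}

/-- Real functions `l i` on a set on which a Coxeter group acts by `φ`, transformed by the simple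
reflections like the simple roots, regarded as functions on the dual of the geometric
representation. The set where all `l i` are nonnegative is the fundamental chamber. -/
def IsSimpleRootFamily (φ : W →* Equiv.Perm Y) (l : B → Y → ℝ) : Prop :=
  ∀ i j y, l i (φ (cs.simple j) y) = l i y + 2 * cos (Real.pi / M i j) * l j y

namespace IsSimpleRootFamily

variable {cs} {φ : W →* Equiv.Perm Y} {l : B → Y → ℝ} (h : IsSimpleRootFamily cs φ l)

include h

theorem apply_simple_self (i : B) (y : Y) : l i (φ (cs.simple i) y) = -l i y := by
  rw [h, M.diagonal, Nat.cast_one, div_one, Real.cos_pi]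
  ring

theorem isReflectionPair (i j : B) :
    IsReflectionPair (cos (Real.pi / M i j)) (φ (cs.simple i)) (φ (cs.simple j)) (l i) (l j) where
  fst_fst := h.apply_simple_self i
  snd_fst y := by rw [h, M.symmetric]
  fst_snd := h i j
  snd_snd := h.apply_simple_self j

theorem apply_alternatingWord_inv (i j : B) (n : ℕ) (y : Y) :
    l i (φ (cs.wordProd (alternatingWord i j n))⁻¹ y) =
      if Even n then
        (U ℝ n).eval (cos (Real.pi / M i j)) * l i y +
          (U ℝ (n - 1)).eval (cos (Real.pi / M i j)) * l j y
      else
        (U ℝ (n - 1)).eval (cos (Real.pi / M i j)) * l i y +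
          (U ℝ n).eval (cos (Real.pi / M i j)) * l j y := by
  have hpow (m : ℕ) (y : Y) := ((h.isReflectionPair j i).apply_mul_pow m y).2
  rw [M.symmetric] at hpow
  rw [cs.prod_alternatingWord_eq_mul_pow, mul_inv_rev, ← inv_pow, mul_inv_rev, cs.inv_simple,
    cs.inv_simple]
  obtain ⟨m, rfl | rfl⟩ := n.even_or_odd'
  · rw [if_pos (even_two_mul m), if_pos (even_two_mul m), inv_one, mul_one,
      Nat.mul_div_cancel_left m two_pos, map_pow, map_mul, hpow]
    push_cast
    ring
  · have hrec : (U ℝ (2 * m + 1)).eval (cos (Real.pi / M i j)) =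
        2 * cos (Real.pi / M i j) * (U ℝ (2 * m)).eval (cos (Real.pi / M i j)) -
          (U ℝ (2 * m - 1)).eval (cos (Real.pi / M i j)) := by
      simp [Polynomial.Chebyshev.U_add_one]
    have hodd : ¬ Even (2 * m + 1) := by simp
    rw [if_neg hodd, if_neg hodd, cs.inv_simple, show (2 * m + 1) / 2 = m by lia, map_mul, map_pow,
      map_mul, Equiv.Perm.mul_apply, hpow, h.apply_simple_self, h]
    push_cast
    rw [add_sub_cancel_right, hrec]
    ring

theorem apply_alternatingWord_inv_pos {i j : B} (hij : i ≠ j) {n : ℕ} (hn : n ≠ 0)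
    (hM : M i j = 0 ∨ n < M i j) {y : Y} (hi : 0 < l i y) (hj : 0 < l j y) :
    0 < l i (φ (cs.wordProd (alternatingWord i j n))⁻¹ y) := by
  obtain ⟨n, rfl⟩ := Nat.exists_eq_succ_of_ne_zero hn
  have hpos := U_eval_cos_pi_div_pos (m := M i j) (n := n) hM
  have hnonneg := U_eval_cos_pi_div_nonneg (m := M i j) (n := n + 1) (M.off_diagonal i j hij)
    (by lia)
  rw [h.apply_alternatingWord_inv]
  simp only [Nat.succ_eq_add_one, Nat.cast_add, Nat.cast_one, add_sub_cancel_right] at hnonneg ⊢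
  split_ifs <;> positivity

theorem pos_of_not_isRightDescent {x : Y} (hx : ∀ i, 0 < l i x) {w : W} {i : B}
    (hi : ¬ cs.IsRightDescent w i) : 0 < l i (φ w⁻¹ x) := by
  induction hlen : cs.length w using Nat.strong_induction_on generalizing w i with
  | _ _ ih =>
    subst hlen
    by_cases hw : w = 1
    · simpa [hw] using hx i
    obtain ⟨j, hj⟩ := cs.exists_rightDescent_of_ne_one hw
    obtain ⟨v, n, hwv, hlen, hvi, hvj⟩ := exists_eq_mul_alternatingWord cs (j := j) hi
    have hn : n ≠ 0 := by
      rintro rfl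
      exact hvj (by simpa [alternatingWord, hwv] using hj)
    have hij : i ≠ j := by
      rintro rfl
      exact hi hj
    have hpos := h.apply_alternatingWord_inv_pos hij hn
      (lt_of_eq_mul_alternatingWord cs hwv hlen hi) (ih _ (by lia) hvi rfl) (ih _ (by lia) hvj rfl)
    rwa [← Equiv.Perm.mul_apply, ← map_mul, ← mul_inv_rev, ← hwv] at hpos

theorem eq_one_of_nonneg {x : Y} (hx : ∀ i, 0 < l i x) {w : W} (hw : ∀ i, 0 ≤ l i (φ w x)) :
    w = 1 := by
  by_contra hne
  obtain ⟨i, hi⟩ := cs.exists_rightDescent_of_ne_one (inv_ne_one.2 hne)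
  have hpos := h.pos_of_not_isRightDescent hx (cs.isRightDescent_iff_not_isRightDescent_mul.1 hi)
  rw [mul_inv_rev, cs.inv_simple, inv_inv, map_mul, Equiv.Perm.mul_apply,
    h.apply_simple_self] at hpos
  linarith [hw i]

end IsSimpleRootFamily

end Tits

section Plane

/-! ### Reflections of the model plane -/

variable {ε : ℝ}

/-- The vector `n♯` dual to a covector `n` with respect to `coForm ε`. -/
def sharp (ε : ℝ) (n : Fin 3 → ℝ) : Fin 3 → ℝ := ![n 0, n 1, ε * n 2]

theorem pair_sharp (m n : Fin 3 → ℝ) : pair m (sharp ε n) = coForm ε m n := by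
  simp only [pair, sharp, coForm, Matrix.cons_val]
  ring

theorem pair_add_smul (n x y : Fin 3 → ℝ) (t : ℝ) :
    pair n (x + t • y) = pair n x + t * pair n y := by
  simp only [pair, Pi.add_apply, Pi.smul_apply, smul_eq_mul]
  ring

theorem coForm_comm (m n : Fin 3 → ℝ) : coForm ε m n = coForm ε n m := by
  simp only [coForm]
  ring

theorem refl_apply {n : Fin 3 → ℝ} (hn : coForm ε n n = 1) (x : Plane ε) :
    (refl n hn x).1 = x.1 + (-2 * pair n x.1) • sharp ε n := by
  change reflFun ε n x.1 = _
  ext i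
  fin_cases i <;> simp [reflFun, sharp] <;> ring

theorem pair_refl (m : Fin 3 → ℝ) {n : Fin 3 → ℝ} (hn : coForm ε n n = 1) (x : Plane ε) :
    pair m (refl n hn x).1 = pair m x.1 - 2 * coForm ε m n * pair n x.1 := by
  rw [refl_apply, pair_add_smul, pair_sharp]
  ring

theorem refl_mul_self {n : Fin 3 → ℝ} (hn : coForm ε n n = 1) : refl n hn * refl n hn = 1 :=
  Equiv.ext fun x => Subtype.ext (reflFun_reflFun hn x.1)

section

variable {m n : Fin 3 → ℝ} (hm : coForm ε m m = 1) (hn : coForm ε n n = 1)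

theorem isReflectionPair_refl {c : ℝ} (hmn : coForm ε m n = -c) :
    IsReflectionPair c (refl m hm) (refl n hn) (fun x => pair m x.1) (fun x => pair n x.1) where
  fst_fst x := by rw [pair_refl, hm]; ring
  snd_fst x := by rw [pair_refl, coForm_comm, hmn]; ring
  fst_snd x := by rw [pair_refl, hmn]; ring
  snd_snd x := by rw [pair_refl, hn]; ring

theorem exists_refl_mul_refl_pow_eq (k : ℕ) (x : Plane ε) : ∃ s t : ℝ,
    (((refl m hm * refl n hn) ^ k) x).1 = x.1 + s • sharp ε m + t • sharp ε n := by
  induction k with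
  | zero => exact ⟨0, 0, by simp⟩
  | succ k ih =>
    obtain ⟨s, t, hst⟩ := ih
    rw [pow_succ', Equiv.Perm.mul_apply, Equiv.Perm.mul_apply, refl_apply, refl_apply, hst]
    generalize -2 * pair m _ = μ
    generalize -2 * pair n _ = ν
    exact ⟨s + μ, t + ν, by module⟩

theorem refl_mul_refl_pow_eq_one {k : ℕ} (hk : 2 ≤ k) (hmn : coForm ε m n = -cos (Real.pi / k)) :
    (refl m hm * refl n hn) ^ k = 1 := by
  refine Equiv.ext fun x => Subtype.ext ?_
  obtain ⟨s, t, hst⟩ := exists_refl_mul_refl_pow_eq hm hn k x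
  obtain ⟨hpm, hpn⟩ := (isReflectionPair_refl hm hn hmn).apply_mul_pow k x
  have hU₀ := U_two_mul_add_eval_cos_pi_div hk 0
  have hU₁ := U_two_mul_add_eval_cos_pi_div hk (-1)
  have hU₂ := U_two_mul_add_eval_cos_pi_div hk (-2)
  rw [← sub_eq_add_neg] at hU₁ hU₂
  rw [add_zero] at hU₀
  rw [hst, pair_add_smul, pair_add_smul, pair_sharp, pair_sharp, hU₁, hU₂, hm, hmn] at hpm
  rw [hst, pair_add_smul, pair_add_smul, pair_sharp, pair_sharp, hU₀, hU₁, hn, coForm_comm,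
    hmn] at hpn
  simp only [Polynomial.Chebyshev.U_neg_two, Polynomial.Chebyshev.U_neg_one,
    Polynomial.Chebyshev.U_zero, Polynomial.eval_neg, Polynomial.eval_one,
    Polynomial.eval_zero] at hpm hpn
  -- `m♯` and `n♯` are linearly independent, since their Gram determinant is `sin² (π/k)`.
  have hs : s = 0 := by
    refine (mul_eq_zero_iff_right (pow_ne_zero 2 (sin_pi_div_pos hk).ne')).1 ?_
    rw [Real.sin_sq]
    linear_combination hpm + cos (Real.pi / k) * hpn
  have ht : t = 0 := by
    rw [hs] at hpn
    linarith
  rw [hst, hs, ht]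
  simp

end

end Plane

section Triangle

/-! ### The triangle group -/

/-- The covectors of the sides of `F`, in the order of the reflections `a`, `b`, `c`. -/
noncomputable def sideNormal (p q : ℕ) : Fin 3 → Fin 3 → ℝ := ![normA, normB p q, normC]

variable {p q : ℕ}

theorem mem_F_iff {x : X p q} : x ∈ F p q ↔ ∀ i, 0 ≤ pair (sideNormal p q i) x.1 := by
  simp [F, sideNormal, Fin.forall_fin_succ]

theorem coForm_sideNormal_self (i : Fin 3) :
    coForm (curv p q) (sideNormal p q i) (sideNormal p q i) = 1 := by
  fin_cases i
  exacts [coForm_normA _, coForm_normB p q, coForm_normC _]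

/-- The reflections `a`, `b`, `c` as a family. -/
noncomputable def sideReflection (p q : ℕ) (i : Fin 3) : Equiv.Perm (X p q) :=
  refl (sideNormal p q i) (coForm_sideNormal_self i)

theorem sideReflection_mul_self (i : Fin 3) : sideReflection p q i * sideReflection p q i = 1 :=
  refl_mul_self _

theorem inv_sideReflection (i : Fin 3) : (sideReflection p q i)⁻¹ = sideReflection p q i :=
  inv_eq_of_mul_eq_one_left (sideReflection_mul_self i)

theorem closure_range_sideReflection :
    Subgroup.closure (Set.range (sideReflection p q)) = G p q := by
  have hrange : Set.range (sideReflection p q) = {a p q, b p q, c p q} := by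
    ext g
    simp only [Set.mem_range, Fin.exists_fin_succ, Set.mem_insert_iff, Set.mem_singleton_iff,
      eq_comm (b := g), or_false, IsEmpty.exists_iff]
    rfl
  rw [hrange, G]

theorem sideReflection_mem_G (i : Fin 3) : sideReflection p q i ∈ G p q :=
  closure_range_sideReflection (p := p) (q := q) ▸ Subgroup.subset_closure ⟨i, rfl⟩

theorem closure_sideReflection_pair_le_G (i j : Fin 3) :
    Subgroup.closure {sideReflection p q i, sideReflection p q j} ≤ G p q :=
  (Subgroup.closure_le _).2 <|
    Set.pair_subset (sideReflection_mem_G i) (sideReflection_mem_G j)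

theorem height_pos (p q : ℕ) : 0 < height p q := by
  rw [height]
  split_ifs with h
  · exact one_pos
  · exact Real.sqrt_pos.2 (abs_pos.2 h)

theorem exists_forall_pair_sideNormal_pos (p q : ℕ) :
    ∃ x : X p q, ∀ i, 0 < pair (sideNormal p q i) x.1 := by
  have hsq : ContinuousAt (fun t => 1 - curv p q * (t ^ 2 + t ^ 2)) 0 := by fun_prop
  have hside : ContinuousAt (fun t => -cos (Real.pi / q) * t + -cos (Real.pi / p) * t +
      height p q * √(1 - curv p q * (t ^ 2 + t ^ 2))) 0 := by fun_prop
  -- The point `(t, t, z)` is close to the vertex `(0, 0, 1)`, which lies off the hypotenuse.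
  obtain ⟨t, ⟨hsq_pos, hside_pos⟩, ht⟩ := ((((hsq.eventually_const_lt (u := 0) (by simp)).and
    (hside.eventually_const_lt (u := 0) (by simpa using height_pos p q))).filter_mono
      nhdsWithin_le_nhds).and (self_mem_nhdsWithin (s := Set.Ioi 0))).exists
  refine ⟨⟨![t, t, √(1 - curv p q * (t ^ 2 + t ^ 2))], ?_, fun _ => Real.sqrt_pos.2 hsq_pos⟩,
    fun i => ?_⟩
  · simp only [Matrix.cons_val]
    rw [Real.sq_sqrt hsq_pos.le]
    ring
  · fin_cases i
    · simpa [sideNormal, normA, pair] using ht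
    · simpa [sideNormal, normB, pair] using hside_pos
    · simpa [sideNormal, normC, pair] using ht

variable (p q) [p.AtLeastTwo] [q.AtLeastTwo]

/-- The Coxeter matrix of the triangle group, whose simple reflections act as `a`, `b`, `c`. -/
def triangleCoxeterMatrix : CoxeterMatrix (Fin 3) where
  M := !![1, q, 2; q, 1, p; 2, p, 1]
  isSymm := by ext i j; fin_cases i <;> fin_cases j <;> rfl
  diagonal i := by fin_cases i <;> rfl
  off_diagonal i j h := by
    have hp := Nat.AtLeastTwo.ne_one (n := p)
    have hq := Nat.AtLeastTwo.ne_one (n := q)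
    fin_cases i <;> fin_cases j <;> simp_all

variable {p q}

theorem two_le_triangleCoxeterMatrix {i j : Fin 3} (h : i ≠ j) :
    2 ≤ triangleCoxeterMatrix p q i j := by
  have hp := Nat.AtLeastTwo.prop (n := p)
  have hq := Nat.AtLeastTwo.prop (n := q)
  fin_cases i <;> fin_cases j <;> simp_all [triangleCoxeterMatrix]

theorem coForm_sideNormal (i j : Fin 3) :
    coForm (curv p q) (sideNormal p q i) (sideNormal p q j) =
      -cos (Real.pi / triangleCoxeterMatrix p q i j) := by
  obtain ⟨hab, hac, hbc⟩ := coForm_angles p q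
  obtain rfl | hij := eq_or_ne i j
  · simp [coForm_sideNormal_self]
  fin_cases i <;> fin_cases j <;> first | exact absurd rfl hij | skip
  exacts [hab, hac, (coForm_comm _ _).trans hab, hbc, (coForm_comm _ _).trans hac,
    (coForm_comm _ _).trans hbc]

theorem isLiftable_sideReflection :
    (triangleCoxeterMatrix p q).IsLiftable (sideReflection p q) := by
  intro i j
  obtain rfl | hij := eq_or_ne i j
  · rw [CoxeterMatrix.diagonal, pow_one, sideReflection_mul_self]
  · exact refl_mul_refl_pow_eq_one _ _ (two_le_triangleCoxeterMatrix hij) (coForm_sideNormal i j)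

variable (p q) in
/-- The action of the abstract Coxeter group on the model plane. -/
noncomputable def triangleAction : (triangleCoxeterMatrix p q).Group →* Equiv.Perm (X p q) :=
  (triangleCoxeterMatrix p q).toCoxeterSystem.lift ⟨sideReflection p q, isLiftable_sideReflection⟩

theorem triangleAction_simple (i : Fin 3) :
    triangleAction p q ((triangleCoxeterMatrix p q).toCoxeterSystem.simple i) =
      sideReflection p q i :=
  CoxeterSystem.lift_apply_simple _ _ i

theorem range_triangleAction : (triangleAction p q).range = G p q := by
  rw [MonoidHom.range_eq_map,
    ← (triangleCoxeterMatrix p q).toCoxeterSystem.subgroup_closure_range_simple,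
    MonoidHom.map_closure, ← Set.range_comp, ← closure_range_sideReflection]
  exact congrArg (fun σ => Subgroup.closure (Set.range σ)) (funext triangleAction_simple)

theorem isSimpleRootFamily_sideNormal :
    IsSimpleRootFamily (triangleCoxeterMatrix p q).toCoxeterSystem (triangleAction p q)
      fun i x => pair (sideNormal p q i) x.1 := by
  intro i j x
  beta_reduce
  rw [triangleAction_simple, sideReflection, pair_refl, coForm_sideNormal]
  ring

theorem eq_one_of_triangleAction_mem_F {x : X p q} (hx : ∀ i, 0 < pair (sideNormal p q i) x.1)
    {w : (triangleCoxeterMatrix p q).Group} (hw : triangleAction p q w x ∈ F p q) : w = 1 :=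
  isSimpleRootFamily_sideNormal.eq_one_of_nonneg hx (mem_F_iff.1 hw)

theorem triangleAction_injective : Function.Injective (triangleAction p q) := by
  obtain ⟨x, hx⟩ := exists_forall_pair_sideNormal_pos p q
  refine (injective_iff_map_eq_one _).2 fun w hw => eq_one_of_triangleAction_mem_F hx ?_
  rw [hw]
  exact mem_F_iff.2 fun i => (hx i).le

theorem mem_of_image_F_subset_iUnion {D : Subgroup (Equiv.Perm (X p q))} (hD : D ≤ G p q)
    {g : Equiv.Perm (X p q)} (hg : g ∈ G p q) (h : g '' F p q ⊆ ⋃ w ∈ D, w '' F p q) : g ∈ D := by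
  obtain ⟨x, hx⟩ := exists_forall_pair_sideNormal_pos p q
  obtain ⟨w, hw, y, hy, hyx⟩ :=
    Set.mem_iUnion₂.1 (h ⟨x, mem_F_iff.2 fun i => (hx i).le, rfl⟩)
  obtain ⟨v, hv⟩ : w⁻¹ * g ∈ (triangleAction p q).range :=
    range_triangleAction (p := p) (q := q) ▸ mul_mem (inv_mem (hD hw)) hg
  have hvx : triangleAction p q v x = y := by
    rw [hv, Equiv.Perm.mul_apply, Equiv.Perm.inv_eq_iff_eq, hyx]
  obtain rfl : v = 1 := eq_one_of_triangleAction_mem_F hx (by rwa [hvx])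
  rw [map_one] at hv
  obtain rfl : w = g := inv_mul_eq_one.1 hv.symm
  exact hw

end Triangle

section Rotations

/-! ### Rotations -/

theorem mem_or_mul_mem_of_mem_closure {A : Type*} [Group A] {H : Subgroup A} {T : Set A} {r : A}
    (hr : r ∈ T) (hleft : ∀ t ∈ T, r * t ∈ H) (hright : ∀ t ∈ T, t * r ∈ H) {g : A}
    (hg : g ∈ Subgroup.closure T) : g ∈ H ∨ g * r ∈ H := by
  induction hg using Subgroup.closure_induction_right with
  | one => exact .inl (one_mem H)
  | mul_right g _ t ht ih =>
    rcases ih with hgH | hgH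
    · exact .inr (mul_assoc g t r ▸ mul_mem hgH (hright t ht))
    · have hmem := mul_mem hgH (mul_mem (inv_mem (hleft r hr)) (hleft t ht))
      exact .inl (by simpa [mul_assoc] using hmem)
  | mul_inv_cancel g _ t ht ih =>
    rcases ih with hgH | hgH
    · have hmem := mul_mem hgH (mul_mem (inv_mem (hleft t ht)) (hleft r hr))
      exact .inr (by simpa [mul_assoc] using hmem)
    · have hmem := mul_mem hgH (inv_mem (hright t ht))
      exact .inl (by simpa [mul_assoc] using hmem)

variable {p q : ℕ}

theorem rotG_le_G : rotG p q ≤ G p q :=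
  (Subgroup.closure_le _).2 <|
    Set.pair_subset (mul_mem (sideReflection_mem_G 0) (sideReflection_mem_G 1))
      (mul_mem (sideReflection_mem_G 0) (sideReflection_mem_G 2))

theorem sideReflection_mul_mem_rotG (i j : Fin 3) :
    sideReflection p q i * sideReflection p q j ∈ rotG p q := by
  have hzero (i : Fin 3) : sideReflection p q 0 * sideReflection p q i ∈ rotG p q := by
    fin_cases i
    exacts [sideReflection_mul_self (p := p) (q := q) 0 ▸ one_mem _, (ab p q).2, (ac p q).2]
  have hmem := mul_mem (inv_mem (hzero i)) (hzero j)
  rwa [mul_inv_rev, mul_assoc, inv_mul_cancel_left, inv_sideReflection] at hmem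

variable (p q) in
/-- The rotation `ab`, `ac` or `bc`, or its inverse, about a vertex of `F`; trivial if `i = j`. -/
noncomputable def rotation (i j : Fin 3) : rotG p q :=
  ⟨sideReflection p q i * sideReflection p q j, sideReflection_mul_mem_rotG i j⟩

theorem rotation_self (i : Fin 3) : rotation p q i i = 1 := Subtype.ext (sideReflection_mul_self i)

theorem inv_rotation (i j : Fin 3) : (rotation p q i j)⁻¹ = rotation p q j i :=
  Subtype.ext <| by simp [rotation, inv_sideReflection]

theorem mem_rotG_or_mul_sideReflection_mem_rotG (i : Fin 3) {g : Equiv.Perm (X p q)}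
    (hg : g ∈ G p q) : g ∈ rotG p q ∨ g * sideReflection p q i ∈ rotG p q := by
  refine mem_or_mul_mem_of_mem_closure (Set.mem_range_self i) ?_ ?_
    (closure_range_sideReflection ▸ hg) <;>
    rintro _ ⟨j, rfl⟩ <;> exact sideReflection_mul_mem_rotG _ _

theorem sideReflection_notMem_rotG [p.AtLeastTwo] [q.AtLeastTwo] (i : Fin 3) :
    sideReflection p q i ∉ rotG p q := by
  let cs := (triangleCoxeterMatrix p q).toCoxeterSystem
  have hle : rotG p q ≤ cs.lengthParity.ker.map (triangleAction p q) := by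
    have hmem (i j : Fin 3) : sideReflection p q i * sideReflection p q j ∈
        cs.lengthParity.ker.map (triangleAction p q) := by
      refine ⟨cs.simple i * cs.simple j, MonoidHom.mem_ker.2 ?_, ?_⟩
      · rw [map_mul, cs.lengthParity_simple, cs.lengthParity_simple]
        decide
      · rw [map_mul, triangleAction_simple, triangleAction_simple]
    exact (Subgroup.closure_le _).2 (Set.pair_subset (hmem 0 1) (hmem 0 2))
  intro hi
  obtain ⟨w, hw, hwi⟩ := hle hi
  obtain rfl := triangleAction_injective (hwi.trans (triangleAction_simple i).symm)
  have heven := MonoidHom.mem_ker.1 hw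
  rw [cs.lengthParity_simple] at heven
  exact absurd heven (by decide)

theorem mem_zpowers_rotation [p.AtLeastTwo] [q.AtLeastTwo] {i j : Fin 3} {f : rotG p q}
    (hf : f.1 ∈ Subgroup.closure {sideReflection p q i, sideReflection p q j}) :
    f ∈ Subgroup.zpowers (rotation p q i j) := by
  have hmap : (Subgroup.zpowers (rotation p q i j)).map (rotG p q).subtype =
      Subgroup.zpowers (sideReflection p q i * sideReflection p q j) :=
    MonoidHom.map_zpowers _ _
  have hright : ∀ t ∈ ({sideReflection p q i, sideReflection p q j} : Set (Equiv.Perm (X p q))),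
      t * sideReflection p q j ∈
        Subgroup.zpowers (sideReflection p q i * sideReflection p q j) := by
    rintro t (rfl | rfl)
    · exact Subgroup.mem_zpowers _
    · exact sideReflection_mul_self (p := p) (q := q) j ▸ one_mem _
  have hleft : ∀ t ∈ ({sideReflection p q i, sideReflection p q j} : Set (Equiv.Perm (X p q))),
      sideReflection p q j * t ∈
        Subgroup.zpowers (sideReflection p q i * sideReflection p q j) := by
    intro t ht
    have hinv : t⁻¹ = t := by rcases ht with rfl | rfl <;> exact inv_sideReflection _
    simpa [inv_sideReflection, hinv] using inv_mem (hright t ht)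
  rcases mem_or_mul_mem_of_mem_closure (.inr rfl) hleft hright hf with hpow | hpow
  · rw [← hmap] at hpow
    exact (Subgroup.mem_map_iff_mem (rotG p q).subtype_injective).1 hpow
  · have hle : Subgroup.zpowers (sideReflection p q i * sideReflection p q j) ≤ rotG p q :=
      Subgroup.zpowers_le.2 (sideReflection_mul_mem_rotG i j)
    exact absurd ((Subgroup.mul_mem_cancel_left _ f.2).1 (hle hpow))
      (sideReflection_notMem_rotG j)

end Rotations

section Tiles

/-! ### Tiles and fundamental domains of the rotation group -/

variable {p q : ℕ}

theorem image_F_subset_polygon {r s w : Equiv.Perm (X p q)} (hw : w ∈ Subgroup.closure {r, s}) :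
    w '' F p q ⊆ polygon p q r s :=
  Set.subset_biUnion_of_mem (u := fun w : Equiv.Perm (X p q) => w '' F p q) hw

theorem F_subset_polygon (r s : Equiv.Perm (X p q)) : F p q ⊆ polygon p q r s := by
  simpa using image_F_subset_polygon (one_mem (Subgroup.closure {r, s}))

theorem image_polygon {r s w : Equiv.Perm (X p q)} (hw : w ∈ Subgroup.closure {r, s}) :
    w '' polygon p q r s = polygon p q r s := by
  have hsub {w : Equiv.Perm (X p q)} (hw : w ∈ Subgroup.closure {r, s}) :
      w '' polygon p q r s ⊆ polygon p q r s := by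
    rw [polygon, Set.image_iUnion₂]
    refine Set.iUnion₂_subset fun v hv => ?_
    rw [← Set.image_comp, ← Equiv.Perm.coe_mul]
    exact image_F_subset_polygon (mul_mem hw hv)
  refine (hsub hw).antisymm ?_
  have hinv := Set.image_mono (f := w) (hsub (inv_mem hw))
  rwa [← Set.image_comp, ← Equiv.Perm.coe_mul, mul_inv_cancel, Equiv.Perm.coe_one,
    Set.image_id] at hinv

theorem tilingOf_comm (r s : Equiv.Perm (X p q)) : tilingOf p q r s = tilingOf p q s r := by
  simp only [tilingOf, polygon, Set.pair_comm r s]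

theorem image_polygon_mem_tilingOf (r s : Equiv.Perm (X p q)) (f : rotG p q) :
    f.1 '' polygon p q r s ∈ tilingOf p q r s :=
  ⟨f, rotG_le_G f.2, rfl⟩

theorem exists_rotation_eq_image_polygon {i : Fin 3} {s : Equiv.Perm (X p q)} {t : Set (X p q)}
    (ht : t ∈ tilingOf p q (sideReflection p q i) s) :
    ∃ f : rotG p q, t = f.1 '' polygon p q (sideReflection p q i) s := by
  obtain ⟨g, hg, rfl⟩ := ht
  rcases mem_rotG_or_mul_sideReflection_mem_rotG i hg with hrot | hrot
  · exact ⟨⟨g, hrot⟩, rfl⟩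
  · refine ⟨⟨_, hrot⟩, ?_⟩
    rw [Equiv.Perm.coe_mul, Set.image_comp,
      image_polygon (Subgroup.subset_closure (Set.mem_insert _ _))]

/-- The two triangles that form the fundamental domain `f (F ∪ r F)` of the rotation group. -/
def domainTriangles (r : Equiv.Perm (X p q)) (f : rotG p q) : Set (Set (X p q)) :=
  {f.1 '' F p q, f.1 '' (r '' F p q)}

theorem exists_mem_domainTriangles (i : Fin 3) {Δ : Set (X p q)} (hΔ : Δ ∈ triangles p q) :
    ∃ f, Δ ∈ domainTriangles (sideReflection p q i) f := by
  obtain ⟨g, hg, rfl⟩ := hΔ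
  rcases mem_rotG_or_mul_sideReflection_mem_rotG i hg with hrot | hrot
  · exact ⟨⟨g, hrot⟩, .inl rfl⟩
  · refine ⟨⟨_, hrot⟩, .inr ?_⟩
    rw [← Set.image_comp, ← Equiv.Perm.coe_mul, mul_assoc, sideReflection_mul_self, mul_one]
    rfl

theorem exists_eq_image_of_mem_domainTriangles {r : Equiv.Perm (X p q)} {f : rotG p q}
    {Δ : Set (X p q)} (hΔ : Δ ∈ domainTriangles r f) :
    ∃ w, (w = 1 ∨ w = r) ∧ Δ = (f.1 * w) '' F p q := by
  rcases hΔ with rfl | rfl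
  · exact ⟨1, .inl rfl, by rw [mul_one]⟩
  · exact ⟨r, .inr rfl, by rw [Equiv.Perm.coe_mul, Set.image_comp]⟩

theorem subset_image_polygon_of_mem_domainTriangles {r s : Equiv.Perm (X p q)} {f : rotG p q}
    {Δ : Set (X p q)} (hΔ : Δ ∈ domainTriangles r f) : Δ ⊆ f.1 '' polygon p q r s := by
  rcases hΔ with rfl | rfl
  · exact Set.image_mono (F_subset_polygon r s)
  · exact Set.image_mono (image_F_subset_polygon (Subgroup.subset_closure (.inl rfl)))

variable [p.AtLeastTwo] [q.AtLeastTwo] {i j : Fin 3} {f f' : rotG p q} {Δ : Set (X p q)}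

theorem inv_mul_mem_zpowers_rotation_of_subset
    (hΔ : Δ ∈ domainTriangles (sideReflection p q i) f)
    (hsub : Δ ⊆ f'.1 '' polygon p q (sideReflection p q i) (sideReflection p q j)) :
    f'⁻¹ * f ∈ Subgroup.zpowers (rotation p q i j) := by
  obtain ⟨w, hw, rfl⟩ := exists_eq_image_of_mem_domainTriangles hΔ
  have hwD : w ∈ Subgroup.closure {sideReflection p q i, sideReflection p q j} := by
    rcases hw with rfl | rfl
    exacts [one_mem _, Subgroup.subset_closure (.inl rfl)]
  have hle := closure_sideReflection_pair_le_G (p := p) (q := q) i j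
  have hmem : f'.1⁻¹ * (f.1 * w) ∈ G p q :=
    mul_mem (inv_mem (rotG_le_G f'.2)) (mul_mem (rotG_le_G f.2) (hle hwD))
  have hwmem := mem_of_image_F_subset_iUnion hle hmem <| by
    have himage := Set.image_mono (f := ⇑(f'.1⁻¹)) hsub
    rwa [← Set.image_comp, ← Set.image_comp, ← Equiv.Perm.coe_mul, ← Equiv.Perm.coe_mul,
      inv_mul_cancel, Equiv.Perm.coe_one, Set.image_id] at himage
  rw [← mul_assoc] at hwmem
  exact mem_zpowers_rotation ((Subgroup.mul_mem_cancel_right _ hwD).1 hwmem)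

theorem eq_of_mem_domainTriangles (hΔ : Δ ∈ domainTriangles (sideReflection p q i) f)
    (hΔ' : Δ ∈ domainTriangles (sideReflection p q i) f') : f = f' := by
  have hmem := inv_mul_mem_zpowers_rotation_of_subset (j := i) hΔ
    (subset_image_polygon_of_mem_domainTriangles hΔ')
  rw [rotation_self, Subgroup.zpowers_one_eq_bot, Subgroup.mem_bot] at hmem
  exact (inv_mul_eq_one.1 hmem).symm

end Tiles

section Colourings

/-! ### Coset colourings -/

theorem exists_equiv_fin_apply_eq_zero {α : Type*} {k : ℕ} (hk : k ≠ 0) (hα : Nat.card α = k)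
    (x : α) : ∃ e : α ≃ Fin k, (e x : ℕ) = 0 := by
  have : Finite α := Nat.finite_of_card_ne_zero (hα ▸ hk)
  let e := Finite.equivFinOfCardEq hα
  exact ⟨e.trans (Equiv.swap (e x) ⟨0, Nat.pos_of_ne_zero hk⟩), by simp⟩

variable {p q k : ℕ} {S : Subgroup (rotG p q)} {i j : Fin 3}

theorem rotation_mem_of_inducesPerfect {r : Equiv.Perm (X p q)}
    (h : InducesPerfect S r k (tilingOf p q (sideReflection p q i) (sideReflection p q j))) :
    rotation p q i j ∈ S := by
  obtain ⟨γ, col, ⟨e, -, hγ⟩, hcol, -⟩ := h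
  let t : tilingOf p q (sideReflection p q i) (sideReflection p q j) :=
    ⟨_, image_polygon_mem_tilingOf _ _ 1⟩
  let triangle (f : rotG p q) : triangles p q := ⟨f.1 '' F p q, f.1, rotG_le_G f.2, rfl⟩
  have hcol_eq {f : rotG p q}
      (hf : f.1 ∈ Subgroup.closure {sideReflection p q i, sideReflection p q j}) :
      col t = e f := by
    rw [← hγ f (triangle f) (.inl rfl)]
    exact hcol t _ ((image_F_subset_polygon hf).trans_eq (Set.image_id _).symm)
  have hrot := hcol_eq (f := rotation p q i j)
    (mul_mem (Subgroup.subset_closure (.inl rfl)) (Subgroup.subset_closure (.inr rfl)))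
  have hone := hcol_eq (f := 1) (one_mem _)
  simpa using QuotientGroup.eq.1 (e.injective (hone.symm.trans hrot))

variable [p.AtLeastTwo] [q.AtLeastTwo]

theorem mk_eq_mk_of_subset (hS : rotation p q i j ∈ S) {f f' : rotG p q} {Δ : Set (X p q)}
    (hΔ : Δ ∈ domainTriangles (sideReflection p q i) f)
    (hsub : Δ ⊆ f'.1 '' polygon p q (sideReflection p q i) (sideReflection p q j)) :
    (f' : rotG p q ⧸ S) = f :=
  QuotientGroup.eq.2 (Subgroup.zpowers_le.2 hS (inv_mul_mem_zpowers_rotation_of_subset hΔ hsub))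

theorem inducesPerfect_of_rotation_mem (hk : k ≠ 0) (hS : S.index = k)
    (hrot : rotation p q i j ∈ S) :
    InducesPerfect S (sideReflection p q i) k
      (tilingOf p q (sideReflection p q i) (sideReflection p q j)) := by
  obtain ⟨e, he⟩ := exists_equiv_fin_apply_eq_zero hk hS ((1 : rotG p q) : rotG p q ⧸ S)
  choose φ hφ using fun Δ : triangles p q => exists_mem_domainTriangles i Δ.2
  choose ψ hψ using fun t : tilingOf p q (sideReflection p q i) (sideReflection p q j) =>
    exists_rotation_eq_image_polygon t.2
  let col (t : tilingOf p q (sideReflection p q i) (sideReflection p q j)) : Fin k :=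
    e (ψ t : rotG p q ⧸ S)
  have hcol (t) (f : rotG p q)
      (ht : t.1 = f.1 '' polygon p q (sideReflection p q i) (sideReflection p q j)) :
      col t = e (f : rotG p q ⧸ S) := by
    refine congrArg e (mk_eq_mk_of_subset hrot (.inl rfl) ?_)
    rw [← hψ t, ht]
    exact Set.image_mono (F_subset_polygon _ _)
  refine ⟨fun Δ => e (φ Δ : rotG p q ⧸ S), col, ⟨e, he, fun f Δ hΔ => ?_⟩, fun t Δ hΔ => ?_,
    fun n => ?_, fun h hh => ?_⟩
  · exact congrArg (fun f : rotG p q => e (f : rotG p q ⧸ S))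
      (eq_of_mem_domainTriangles (hφ Δ) hΔ)
  · rw [hψ t] at hΔ
    exact congrArg e (mk_eq_mk_of_subset hrot (hφ Δ) hΔ)
  · obtain ⟨f, hf⟩ := QuotientGroup.mk_surjective (e.symm n)
    refine ⟨⟨_, image_polygon_mem_tilingOf _ _ f⟩, ?_⟩
    rw [hcol _ f rfl, hf, e.apply_symm_apply]
  · refine ⟨(e.symm.trans (MulAction.toPerm (⟨h, hh⟩ : rotG p q))).trans e, fun t => ?_⟩
    have himage : h '' t.1 = (⟨h, hh⟩ * ψ t : rotG p q).1 ''
        polygon p q (sideReflection p q i) (sideReflection p q j) := by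
      rw [hψ t, ← Set.image_comp]
      rfl
    refine ⟨himage ▸ image_polygon_mem_tilingOf _ _ _, ?_⟩
    rw [hcol _ _ himage]
    simp [col]

theorem inducesPerfect_iff_rotation_mem (hk : k ≠ 0) (hS : S.index = k) (i j : Fin 3) :
    ∀ r ∈ ({sideReflection p q i, sideReflection p q j} : Set (Equiv.Perm (X p q))),
      (InducesPerfect S r k (tilingOf p q (sideReflection p q i) (sideReflection p q j)) ↔
        rotation p q i j ∈ S) := by
  rintro r (rfl | rfl)
  · exact ⟨rotation_mem_of_inducesPerfect, inducesPerfect_of_rotation_mem hk hS⟩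
  · refine ⟨rotation_mem_of_inducesPerfect, fun hrot => ?_⟩
    rw [tilingOf_comm]
    exact inducesPerfect_of_rotation_mem hk hS (inv_rotation i j ▸ inv_mem hrot)

end Colourings

end RegTiling

theorem mainTheorem2_general (p q : ℕ) (hp : 2 ≤ p) (hq : 2 ≤ q) (k : ℕ) (hk : k ≠ 0)
    (S : Subgroup (RegTiling.rotG p q)) (hS : S.index = k) :
    (∀ r ∈ ({RegTiling.a p q, RegTiling.b p q} : Set (Equiv.Perm (RegTiling.X p q))),
      (RegTiling.InducesPerfect S r k (RegTiling.tilingQP p q) ↔ RegTiling.ab p q ∈ S)) ∧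
    (∀ r ∈ ({RegTiling.a p q, RegTiling.c p q} : Set (Equiv.Perm (RegTiling.X p q))),
      (RegTiling.InducesPerfect S r k (RegTiling.tilingLaves p q) ↔ RegTiling.ac p q ∈ S)) ∧
    (∀ r ∈ ({RegTiling.b p q, RegTiling.c p q} : Set (Equiv.Perm (RegTiling.X p q))),
      (RegTiling.InducesPerfect S r k (RegTiling.tilingPQ p q) ↔ RegTiling.bc p q ∈ S)) := by
  have : p.AtLeastTwo := ⟨hp⟩
  have : q.AtLeastTwo := ⟨hq⟩
  exact ⟨RegTiling.inducesPerfect_iff_rotation_mem hk hS 0 1,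
    RegTiling.inducesPerfect_iff_rotation_mem hk hS 0 2,
    RegTiling.inducesPerfect_iff_rotation_mem hk hS 1 2⟩

theorem mainTheorem2 (p q : ℕ) (hp : 3 ≤ p) (hq : 3 ≤ q) (k : ℕ) (hk : k ≠ 0)
    (S : Subgroup (RegTiling.rotG p q)) (hS : S.index = k) :
    (∀ r ∈ ({RegTiling.a p q, RegTiling.b p q} : Set (Equiv.Perm (RegTiling.X p q))),
      (RegTiling.InducesPerfect S r k (RegTiling.tilingQP p q) ↔ RegTiling.ab p q ∈ S)) ∧
    (∀ r ∈ ({RegTiling.a p q, RegTiling.c p q} : Set (Equiv.Perm (RegTiling.X p q))),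
      (RegTiling.InducesPerfect S r k (RegTiling.tilingLaves p q) ↔ RegTiling.ac p q ∈ S)) ∧
    (∀ r ∈ ({RegTiling.b p q, RegTiling.c p q} : Set (Equiv.Perm (RegTiling.X p q))),
      (RegTiling.InducesPerfect S r k (RegTiling.tilingPQ p q) ↔ RegTiling.bc p q ∈ S)) :=
  mainTheorem2_general p q (Nat.le_of_succ_le hp) (Nat.le_of_succ_le hq) k hk S hS
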